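/- Let $\mathcal C$ be a braided monoidal category with tensor product $\otimes$, unit object $K$ and braiding $c$, which admits equalizers and coequalizers (associativity and unit isomorphisms are suppressed from the notation, and an object also denotes its identity morphism). Let $H$ be an object of $\mathcal C$ with a monoid structure $(H,\eta,\mu)$ and a comonoid structure $(H,\varepsilon,\delta)$ such that (b1) $\delta\circ\mu=(\mu\otimes\mu)\circ(H\otimes c_{H,H}\otimes H)\circ(\delta\otimes\delta)$; (b2) $\varepsilon\circ\mu\circ(\mu\otimes H)=((\varepsilon\circ\mu)\otimes(\varepsilon\circ\mu))\circ(H\otimes\delta\otimes H)=((\varepsilon\circ\mu)\otimes(\varepsilon\circ\mu))\circ(H\otimes(c_{H,H}^{-1}\circ\delta)\otimes H)$; (b3) $(\delta\otimes H)\circ\delta\circ\eta=(H\otimes\mu\otimes H)\circ((\delta\circ\eta)\otimes(\delta\circ\eta))=(H\otimes(\mu\circ c_{H,H}^{-1})\otimes H)\circ((\delta\circ\eta)\otimes(\delta\circ\eta))$. Put $$\Pi^L=((\varepsilon\circ\mu)\otimes H)\circ(H\otimes c_{H,H})\circ((\delta\circ\eta)\otimes H),\qquad \Pi^R=(H\otimes(\varepsilon\circ\mu))\circ(c_{H,H}\otimes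 H)\circ(H\otimes(\delta\circ\eta)),$$ and write $f*g=\mu\circ(f\otimes g)\circ\delta$ for $f,g:H\to H$. One says that $H$ is a weak Hopf algebra if, in addition to (b1)–(b3), there is a morphism $\lambda:H\to H$ with $$H*\lambda=\Pi^L,\qquad \lambda*H=\Pi^R,\qquad \lambda*\Pi^L=\Pi^R*\lambda=\lambda,$$ $$\mu\circ(\lambda\otimes\mu)\circ(\delta\otimes H)=\mu\circ(\Pi^R\otimes H),\qquad \mu\circ(H\otimes\mu)\circ(H\otimes\lambda\otimes H)\circ(\delta\otimes H)=\mu\circ(\Pi^L\otimes H),$$ $$\mu\circ(\mu\otimes\lambda)\circ(H\otimes\delta)=\mu\circ(H\otimes\Pi^L),\qquad \mu\circ(\mu\otimes H)\circ(H\otimes\lambda\otimes H)\circ(H\otimes\delta)=\mu\circ(H\otimes\Pi^R)$$ (the last four equalities follow from the first ones by associativity). For $\sigma\in\{L,R\}$ define endomorphisms of $H\otimes H$ by $$\Omega_\sigma^1=(\mu\otimes H)\circ(H\otimes\Pi^\sigma\otimes H)\circ(H\otimes\delta),\qquad \Omega_\sigma^2=(H\otimes\mu)\circ(H\otimes\Pi^\sigma\otimes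 H)\circ(\delta\otimes H),$$ and let $\beta=(\mu\otimes H)\circ(H\otimes\delta)$ and $\gamma=(H\otimes\mu)\circ(\delta\otimes H)$ be the right and left Galois morphisms. Then the four morphisms $\Omega_\sigma^\alpha$ ($\sigma\in\{L,R\}$, $\alpha\in\{1,2\}$) are split idempotents: there are objects $H\times_\sigma^\alpha H$ and morphisms $q_\sigma^\alpha:H\otimes H\to H\times_\sigma^\alpha H$, $j_\sigma^\alpha:H\times_\sigma^\alpha H\to H\otimes H$ with $j_\sigma^\alpha\circ q_\sigma^\alpha=\Omega_\sigma^\alpha$ and $q_\sigma^\alpha\circ j_\sigma^\alpha=id$. For every choice of such splittings, the following assertions are equivalent: (i) $H$ is a weak Hopf algebra; (ii) the morphism $h=q_L^2\circ\gamma\circ j_R^2:H\times_R^2H\to H\times_L^2H$ is an isomorphism; (iii) the morphism $s=q_R^1\circ\beta\circ j_L^1:H\times_L^1H\to H\times_R^1H$ is an isomorphism. -/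

import Mathlib

open CategoryTheory MonoidalCategory
open scoped MonObj ComonObj

universe v u

namespace WeakHopf

section

/-- A splitting of an endomorphism `e`: a factorization `e = j ∘ q` with `q ∘ j = id`. -/
structure IdemSplitting {C : Type u} [Category.{v} C] {X : C} (e : X ⟶ X) where
  /-- the image object -/
  obj : C
  /-- the projection onto the image -/
  q : X ⟶ obj
  /-- the inclusion of the image -/
  j : obj ⟶ X
  q_j : q ≫ j = e
  j_q : j ≫ q = 𝟙 obj

variable {C : Type u} [Category.{v} C] [MonoidalCategory C] [BraidedCategory C]
variable (H : C) [MonObj H] [ComonObj H]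

/-- The compatibility conditions between the product and the coproduct of an object which is
both a monoid and a comonoid.  The two equalities
`ε ∘ μ ∘ (μ ⊗ H) = ε ∘ μ ∘ (H ⊗ μ)` and `(δ ⊗ H) ∘ δ ∘ η = (H ⊗ δ) ∘ δ ∘ η`
are not listed, because they are instances of associativity and of coassociativity. -/
structure IsWeakBimonoid : Prop where
  /-- `δ ∘ μ = (μ ⊗ μ) ∘ (H ⊗ c ⊗ H) ∘ (δ ⊗ δ)` -/
  mul_comul : μ[H] ≫ Δ[H] = (Δ[H] ⊗ₘ Δ[H]) ≫ tensorμ H H H H ≫ (μ[H] ⊗ₘ μ[H])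
  /-- `ε ∘ μ ∘ (μ ⊗ H) = ((ε ∘ μ) ⊗ (ε ∘ μ)) ∘ (H ⊗ δ ⊗ H)` -/
  mul_counit : μ[H] ▷ H ≫ μ[H] ≫ ε[H] =
    (H ◁ Δ[H]) ▷ H ≫ (α_ H H H).inv ▷ H ≫ (α_ (H ⊗ H) H H).hom ≫
      ((μ[H] ≫ ε[H]) ⊗ₘ (μ[H] ≫ ε[H])) ≫ (λ_ (𝟙_ C)).hom
  /-- `ε ∘ μ ∘ (μ ⊗ H) = ((ε ∘ μ) ⊗ (ε ∘ μ)) ∘ (H ⊗ (c⁻¹ ∘ δ) ⊗ H)` -/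
  mul_counit_braid : μ[H] ▷ H ≫ μ[H] ≫ ε[H] =
    (H ◁ (Δ[H] ≫ (β_ H H).inv)) ▷ H ≫ (α_ H H H).inv ▷ H ≫ (α_ (H ⊗ H) H H).hom ≫
      ((μ[H] ≫ ε[H]) ⊗ₘ (μ[H] ≫ ε[H])) ≫ (λ_ (𝟙_ C)).hom
  /-- `(δ ⊗ H) ∘ δ ∘ η = (H ⊗ μ ⊗ H) ∘ ((δ ∘ η) ⊗ (δ ∘ η))` -/
  one_comul : η[H] ≫ Δ[H] ≫ Δ[H] ▷ H =
    (λ_ (𝟙_ C)).inv ≫ ((η[H] ≫ Δ[H]) ⊗ₘ (η[H] ≫ Δ[H])) ≫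
      (α_ (H ⊗ H) H H).inv ≫ (α_ H H H).hom ▷ H ≫ (H ◁ μ[H]) ▷ H
  /-- `(δ ⊗ H) ∘ δ ∘ η = (H ⊗ (μ ∘ c⁻¹) ⊗ H) ∘ ((δ ∘ η) ⊗ (δ ∘ η))` -/
  one_comul_braid : η[H] ≫ Δ[H] ≫ Δ[H] ▷ H =
    (λ_ (𝟙_ C)).inv ≫ ((η[H] ≫ Δ[H]) ⊗ₘ (η[H] ≫ Δ[H])) ≫
      (α_ (H ⊗ H) H H).inv ≫ (α_ H H H).hom ▷ H ≫ (H ◁ ((β_ H H).inv ≫ μ[H])) ▷ H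

/-- The target morphism `Π^L = ((ε ∘ μ) ⊗ H) ∘ (H ⊗ c) ∘ ((δ ∘ η) ⊗ H)`. -/
def piL : H ⟶ H :=
  (λ_ H).inv ≫ (η[H] ≫ Δ[H]) ▷ H ≫ (α_ H H H).hom ≫ H ◁ (β_ H H).hom ≫
    (α_ H H H).inv ≫ (μ[H] ≫ ε[H]) ▷ H ≫ (λ_ H).hom

/-- The source morphism `Π^R = (H ⊗ (ε ∘ μ)) ∘ (c ⊗ H) ∘ (H ⊗ (δ ∘ η))`. -/
def piR : H ⟶ H :=
  (ρ_ H).inv ≫ H ◁ (η[H] ≫ Δ[H]) ≫ (α_ H H H).inv ≫ (β_ H H).hom ▷ H ≫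
    (α_ H H H).hom ≫ H ◁ (μ[H] ≫ ε[H]) ≫ (ρ_ H).hom

variable {H} in
/-- The convolution product `f * g = μ ∘ (f ⊗ g) ∘ δ`. -/
def conv (f g : H ⟶ H) : H ⟶ H := Δ[H] ≫ (f ⊗ₘ g) ≫ μ[H]

/-- The axioms for an antipode. -/
structure IsAntipode (s : H ⟶ H) : Prop where
  /-- `id * s = Π^L` -/
  id_conv : conv (𝟙 H) s = piL H
  /-- `s * id = Π^R` -/
  conv_id : conv s (𝟙 H) = piR H
  /-- `s * Π^L = s` -/
  conv_piL : conv s (piL H) = s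
  /-- `Π^R * s = s` -/
  piR_conv : conv (piR H) s = s
  /-- `μ ∘ (s ⊗ μ) ∘ (δ ⊗ H) = μ ∘ (Π^R ⊗ H)` -/
  left_piR : Δ[H] ▷ H ≫ (α_ H H H).hom ≫ (s ⊗ₘ μ[H]) ≫ μ[H] = piR H ▷ H ≫ μ[H]
  /-- `μ ∘ (H ⊗ μ) ∘ (H ⊗ s ⊗ H) ∘ (δ ⊗ H) = μ ∘ (Π^L ⊗ H)` -/
  left_piL : Δ[H] ▷ H ≫ (α_ H H H).hom ≫ H ◁ (s ▷ H) ≫ H ◁ μ[H] ≫ μ[H] = piL H ▷ H ≫ μ[H]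
  /-- `μ ∘ (μ ⊗ s) ∘ (H ⊗ δ) = μ ∘ (H ⊗ Π^L)` -/
  right_piL : H ◁ Δ[H] ≫ (α_ H H H).inv ≫ (μ[H] ⊗ₘ s) ≫ μ[H] = H ◁ piL H ≫ μ[H]
  /-- `μ ∘ (μ ⊗ H) ∘ (H ⊗ s ⊗ H) ∘ (H ⊗ δ) = μ ∘ (H ⊗ Π^R)` -/
  right_piR : H ◁ Δ[H] ≫ (α_ H H H).inv ≫ (H ◁ s) ▷ H ≫ μ[H] ▷ H ≫ μ[H] = H ◁ piR H ≫ μ[H]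

/-- A weak Hopf algebra in a braided category. -/
structure IsWeakHopfAlgebra : Prop where
  isWeakBimonoid : IsWeakBimonoid H
  exists_antipode : ∃ s : H ⟶ H, IsAntipode H s

/-- `Ω_L^1 = (μ ⊗ H) ∘ (H ⊗ Π^L ⊗ H) ∘ (H ⊗ δ)` -/
def omegaL1 : H ⊗ H ⟶ H ⊗ H :=
  H ◁ Δ[H] ≫ (α_ H H H).inv ≫ (H ◁ piL H) ▷ H ≫ μ[H] ▷ H

/-- `Ω_R^1 = (μ ⊗ H) ∘ (H ⊗ Π^R ⊗ H) ∘ (H ⊗ δ)` -/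
def omegaR1 : H ⊗ H ⟶ H ⊗ H :=
  H ◁ Δ[H] ≫ (α_ H H H).inv ≫ (H ◁ piR H) ▷ H ≫ μ[H] ▷ H

/-- `Ω_L^2 = (H ⊗ μ) ∘ (H ⊗ Π^L ⊗ H) ∘ (δ ⊗ H)` -/
def omegaL2 : H ⊗ H ⟶ H ⊗ H :=
  Δ[H] ▷ H ≫ (α_ H H H).hom ≫ H ◁ (piL H ▷ H) ≫ H ◁ μ[H]

/-- `Ω_R^2 = (H ⊗ μ) ∘ (H ⊗ Π^R ⊗ H) ∘ (δ ⊗ H)` -/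
def omegaR2 : H ⊗ H ⟶ H ⊗ H :=
  Δ[H] ▷ H ≫ (α_ H H H).hom ≫ H ◁ (piR H ▷ H) ≫ H ◁ μ[H]

/-- The right Galois morphism `β = (μ ⊗ H) ∘ (H ⊗ δ)`. -/
def galoisRight : H ⊗ H ⟶ H ⊗ H :=
  H ◁ Δ[H] ≫ (α_ H H H).inv ≫ μ[H] ▷ H

/-- The left Galois morphism `γ = (H ⊗ μ) ∘ (δ ⊗ H)`. -/
def galoisLeft : H ⊗ H ⟶ H ⊗ H :=
  Δ[H] ▷ H ≫ (α_ H H H).hom ≫ H ◁ μ[H]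

variable {H}

/-- The morphism `h = q_L^2 ∘ γ ∘ j_R^2` between the images of `Ω_R^2` and `Ω_L^2`. -/
def hMor (R2 : IdemSplitting (omegaR2 H)) (L2 : IdemSplitting (omegaL2 H)) : R2.obj ⟶ L2.obj :=
  R2.j ≫ galoisLeft H ≫ L2.q

/-- The morphism `s = q_R^1 ∘ β ∘ j_L^1` between the images of `Ω_L^1` and `Ω_R^1`. -/
def sMor (L1 : IdemSplitting (omegaL1 H)) (R1 : IdemSplitting (omegaR1 H)) : L1.obj ⟶ R1.obj :=
  L1.j ≫ galoisRight H ≫ R1.q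

end

end WeakHopf

/-! The idea is to replace endomorphisms of `H ⊗ H` by the convolution algebra of endomorphisms of
`H`. The assignment `f ↦ (x ⊗ y ↦ x f(y₁) ⊗ y₂)` is injective and multiplicative for `conv`, and its
image consists of the left linear, right colinear endomorphisms. It sends `Π^L`, `Π^R`, `id` to
`Ω_L^1`, `Ω_R^1`, `β`. The mirror assignment `x ⊗ y ↦ x₁ ⊗ f(x₂) y` reverses products and yields
`Ω_L^2`, `Ω_R^2`, `γ`.

The weak bimonoid axioms enter only through four identities: `Π^L * Π^L = Π^L`, `Π^R * Π^R = Π^R`,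
`Π^L * id = id` and `id * Π^R = id`. The first two make the `Ω` idempotent. The last two say that
`β` and `γ` absorb the relevant idempotents, so `s` or `h` is invertible exactly when `β` or `γ` has
a generalized inverse relative to them (`isIso_iff_exists_isGenInverse`). Such an inverse is again
linear and colinear, hence comes from some `f : H ⟶ H`, and injectivity turns its equations into the
antipode axioms for `f`. -/

namespace WeakHopf

/-! ### Split idempotents and generalized inverses. -/

section Idempotents

variable {C : Type u} [Category.{v} C]

theorem IdemSplitting.nonempty_of_idem [Limits.HasEqualizers C] {X : C} {e : X ⟶ X}
    (he : e ≫ e = e) : Nonempty (IdemSplitting e) :=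
  ⟨{ obj := Limits.equalizer (𝟙 X) e
     q := Limits.equalizer.lift e (by simp [he])
     j := Limits.equalizer.ι (𝟙 X) e
     q_j := by simp
     j_q := by
      ext
      simpa using (Limits.equalizer.condition (𝟙 X) e).symm }⟩

theorem IdemSplitting.comp_q {X : C} {e : X ⟶ X} (S : IdemSplitting e) : e ≫ S.q = S.q := by
  simpa [S.j_q] using congrArg (· ≫ S.q) S.q_j.symm

theorem IdemSplitting.j_comp {X : C} {e : X ⟶ X} (S : IdemSplitting e) : S.j ≫ e = S.j := by
  simpa [reassoc_of% S.j_q] using congrArg (S.j ≫ ·) S.q_j.symm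

/-- `b'` is a generalized inverse of `b` with `b ≫ b' = e₁` and `b' ≫ b = e₂`. -/
structure IsGenInverse {X : C} (e₁ e₂ b b' : X ⟶ X) : Prop where
  comp_inv : b ≫ b' = e₁
  inv_comp : b' ≫ b = e₂
  idem_comp : e₂ ≫ b' = b'
  comp_idem : b' ≫ e₁ = b'

/-- The morphism induced by `b` between the images of `e₁` and `e₂` is invertible if and only if
`b` has a generalized inverse. -/
theorem isIso_iff_exists_isGenInverse {X : C} {e₁ e₂ b : X ⟶ X}
    (S₁ : IdemSplitting e₁) (S₂ : IdemSplitting e₂) (h₁ : e₁ ≫ b = b) (h₂ : b ≫ e₂ = b) :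
    IsIso (S₁.j ≫ b ≫ S₂.q) ↔ ∃ b', IsGenInverse e₁ e₂ b b' := by
  have q₁ := S₁.comp_q
  have q₂ := S₂.comp_q
  have j₁ := S₁.j_comp
  have j₂ := S₂.j_comp
  constructor
  · intro _
    set s := S₁.j ≫ b ≫ S₂.q with hs
    -- Since `b` absorbs `e₁` and `e₂`, it is recovered from the map between the images; the
    -- generalized inverse is then `inv s` transported back to `X`.
    have hb : b = S₁.q ≫ s ≫ S₂.j := by
      simp only [hs, Category.assoc, S₂.q_j, reassoc_of% S₁.q_j]
      rw [h₂, h₁]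
    refine ⟨S₂.q ≫ inv s ≫ S₁.j, ?_, ?_, ?_, ?_⟩
    · rw [hb]
      simp [reassoc_of% S₂.j_q, S₁.q_j]
    · rw [hb]
      simp [reassoc_of% S₁.j_q, S₂.q_j]
    · rw [reassoc_of% q₂]
    · simp only [Category.assoc, j₁]
  · rintro ⟨b', hb⟩
    refine ⟨S₂.j ≫ b' ≫ S₁.q, ?_, ?_⟩
    · simp only [Category.assoc, reassoc_of% S₂.q_j]
      rw [reassoc_of% hb.idem_comp, reassoc_of% hb.comp_inv, q₁, S₁.j_q]
    · simp only [Category.assoc, reassoc_of% S₁.q_j]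
      rw [reassoc_of% h₁, reassoc_of% hb.inv_comp, q₂, S₂.j_q]

/-- A generalized inverse of a morphism of `F`-algebras is a morphism of `F`-algebras. -/
theorem IsGenInverse.map_comp_algebra {X : C} {e₁ e₂ b b' : X ⟶ X}
    (hb : IsGenInverse e₁ e₂ b b') (F : C ⥤ C) (l : F.obj X ⟶ X) (h : F.map b ≫ l = l ≫ b)
    (h₁ : F.map e₁ ≫ l = l ≫ e₁) (h₂ : F.map e₂ ≫ l = l ≫ e₂) :
    F.map b' ≫ l = l ≫ b' := by
  -- The usual argument that the inverse of a linear isomorphism is linear, with the idempotents in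
  -- place of identities. No axioms on the action `l` are needed.
  calc F.map b' ≫ l = F.map b' ≫ F.map e₁ ≫ l := by rw [← F.map_comp_assoc, hb.comp_idem]
    _ = F.map b' ≫ F.map b ≫ l ≫ b' := by rw [h₁, ← hb.comp_inv, reassoc_of% h]
    _ = l ≫ e₂ ≫ b' := by rw [← F.map_comp_assoc, hb.inv_comp, reassoc_of% h₂]
    _ = l ≫ b' := by rw [hb.idem_comp]

/-- A generalized inverse of a morphism of `F`-coalgebras is a morphism of `F`-coalgebras. -/
theorem IsGenInverse.comp_map_coalgebra {X : C} {e₁ e₂ b b' : X ⟶ X}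
    (hb : IsGenInverse e₁ e₂ b b') (F : C ⥤ C) (r : X ⟶ F.obj X) (h : b ≫ r = r ≫ F.map b)
    (h₁ : e₁ ≫ r = r ≫ F.map e₁) (h₂ : e₂ ≫ r = r ≫ F.map e₂) :
    b' ≫ r = r ≫ F.map b' := by
  calc b' ≫ r = b' ≫ e₁ ≫ r := by rw [reassoc_of% hb.comp_idem]
    _ = b' ≫ b ≫ r ≫ F.map b' := by
      rw [h₁, ← hb.comp_inv, F.map_comp, reassoc_of% h]
    _ = e₂ ≫ r ≫ F.map b' := by rw [reassoc_of% hb.inv_comp]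
    _ = r ≫ F.map b' := by rw [reassoc_of% h₂, ← F.map_comp, hb.idem_comp]

end Idempotents

/-! ### The convolution algebra inside the endomorphisms of `H ⊗ H`. -/

section Convolution

variable {C : Type u} [Category.{v} C] [MonoidalCategory C] {H : C} [MonObj H] [ComonObj H]

variable (H)

/-- The endomorphism `x ⊗ y ↦ x f(y₁) ⊗ y₂` of `H ⊗ H`. -/
def rightGalois (f : H ⟶ H) : H ⊗ H ⟶ H ⊗ H :=
  H ◁ Δ[H] ≫ (α_ H H H).inv ≫ (H ◁ f) ▷ H ≫ μ[H] ▷ H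

/-- The endomorphism `x ⊗ y ↦ x₁ ⊗ f(x₂) y` of `H ⊗ H`. -/
def leftGalois (f : H ⟶ H) : H ⊗ H ⟶ H ⊗ H :=
  Δ[H] ▷ H ≫ (α_ H H H).hom ≫ H ◁ (f ▷ H) ≫ H ◁ μ[H]

variable {H}

/-- By associativity and coassociativity, both sides are `x ⊗ y ↦ x f(y₁) g(y₂) ⊗ y₃`. -/
theorem rightGalois_comp (f g : H ⟶ H) :
    rightGalois H f ≫ rightGalois H g = rightGalois H (conv f g) := by
  calc rightGalois H f ≫ rightGalois H g
      = 𝟙 _ ⊗≫ H ◁ Δ[H] ⊗≫ ((H ◁ f ≫ μ[H]) ▷ H ≫ H ◁ Δ[H]) ⊗≫ (H ◁ g ≫ μ[H]) ▷ H ⊗≫ 𝟙 _ := by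
        simp only [rightGalois]; monoidal
    _ = 𝟙 _ ⊗≫ H ◁ (Δ[H] ≫ H ◁ Δ[H]) ⊗≫ ((H ◁ f ≫ μ[H]) ▷ H ≫ H ◁ g) ▷ H ⊗≫ μ[H] ▷ H
          ⊗≫ 𝟙 _ := by
        rw [← whisker_exchange]; monoidal
    _ = 𝟙 _ ⊗≫ H ◁ (Δ[H] ≫ Δ[H] ▷ H) ⊗≫ ((H ⊗ H) ◁ g) ▷ H ⊗≫ ((H ◁ f) ▷ H) ▷ H ⊗≫
          (μ[H] ▷ H ≫ μ[H]) ▷ H ⊗≫ 𝟙 _ := by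
        rw [← whisker_exchange, ComonObj.comul_assoc]; monoidal
    _ = 𝟙 _ ⊗≫ H ◁ (Δ[H] ≫ Δ[H] ▷ H) ⊗≫ (H ◁ (H ◁ g ≫ f ▷ H)) ▷ H ⊗≫
          (H ◁ μ[H] ≫ μ[H]) ▷ H ⊗≫ 𝟙 _ := by
        rw [MonObj.mul_assoc]; monoidal
    _ = rightGalois H (conv f g) := by
        rw [whisker_exchange]; simp only [rightGalois, conv, MonoidalCategory.tensorHom_def]; monoidal

/-- The order is reversed: the second map acts to the left of the first, giving `x₁ ⊗ g(x₂) f(x₃)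
y`. -/
theorem leftGalois_comp (f g : H ⟶ H) :
    leftGalois H f ≫ leftGalois H g = leftGalois H (conv g f) := by
  calc leftGalois H f ≫ leftGalois H g
      = 𝟙 _ ⊗≫ Δ[H] ▷ H ⊗≫ (H ◁ (f ▷ H ≫ μ[H]) ≫ Δ[H] ▷ H) ⊗≫ H ◁ (g ▷ H ≫ μ[H]) ⊗≫ 𝟙 _ := by
        simp only [leftGalois]; monoidal
    _ = 𝟙 _ ⊗≫ (Δ[H] ≫ Δ[H] ▷ H) ▷ H ⊗≫ H ◁ (H ◁ (f ▷ H ≫ μ[H]) ≫ g ▷ H) ⊗≫ H ◁ μ[H]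
          ⊗≫ 𝟙 _ := by
        rw [whisker_exchange]; monoidal
    _ = 𝟙 _ ⊗≫ (Δ[H] ≫ Δ[H] ▷ H) ▷ H ⊗≫ H ◁ (g ▷ H ≫ H ◁ f) ▷ H ⊗≫
          H ◁ (H ◁ μ[H] ≫ μ[H]) ⊗≫ 𝟙 _ := by
        rw [whisker_exchange]; monoidal
    _ = leftGalois H (conv g f) := by
        rw [MonObj.mul_assoc_flip, ComonObj.comul_assoc_flip]
        simp only [leftGalois, conv, MonoidalCategory.tensorHom_def]; monoidal

/-- Putting `x = 1` and applying `ε` to the second leg recovers `f`; this gives injectivity. -/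
theorem rightGalois_eval (f : H ⟶ H) :
    (λ_ H).inv ≫ η[H] ▷ H ≫ rightGalois H f ≫ H ◁ ε[H] ≫ (ρ_ H).hom = f := by
  calc _ = 𝟙 _ ⊗≫ (η[H] ▷ H ≫ H ◁ Δ[H]) ⊗≫ (H ◁ f ≫ μ[H]) ▷ H ⊗≫ H ◁ ε[H] ⊗≫ 𝟙 _ := by
        simp only [rightGalois]; monoidal
    _ = Δ[H] ⊗≫ ((η[H] ▷ H ≫ H ◁ f ≫ μ[H]) ▷ H ≫ H ◁ ε[H]) ⊗≫ 𝟙 _ := by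
        rw [← whisker_exchange]; monoidal
    _ = (Δ[H] ≫ H ◁ ε[H]) ⊗≫ (η[H] ▷ H ≫ H ◁ f) ⊗≫ μ[H] := by
        rw [← whisker_exchange]; monoidal
    _ = 𝟙 _ ⊗≫ f ⊗≫ (η[H] ▷ H ≫ μ[H]) := by
        rw [← whisker_exchange, ComonObj.comul_counit]; monoidal
    _ = f := by
        rw [MonObj.one_mul]; monoidal

theorem leftGalois_eval (f : H ⟶ H) :
    (ρ_ H).inv ≫ H ◁ η[H] ≫ leftGalois H f ≫ ε[H] ▷ H ≫ (λ_ H).hom = f := by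
  calc _ = 𝟙 _ ⊗≫ (H ◁ η[H] ≫ Δ[H] ▷ H) ⊗≫ H ◁ (f ▷ H ≫ μ[H]) ⊗≫ ε[H] ▷ H ⊗≫ 𝟙 _ := by
        simp only [leftGalois]; monoidal
    _ = Δ[H] ⊗≫ (H ◁ (H ◁ η[H] ≫ f ▷ H ≫ μ[H]) ≫ ε[H] ▷ H) ⊗≫ 𝟙 _ := by
        rw [whisker_exchange]; monoidal
    _ = (Δ[H] ≫ ε[H] ▷ H) ⊗≫ (H ◁ η[H] ≫ f ▷ H) ⊗≫ μ[H] := by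
        rw [whisker_exchange]; monoidal
    _ = 𝟙 _ ⊗≫ f ⊗≫ (H ◁ η[H] ≫ μ[H]) := by
        rw [whisker_exchange, ComonObj.counit_comul]; monoidal
    _ = f := by
        rw [MonObj.mul_one]; monoidal

theorem rightGalois_injective : Function.Injective (rightGalois H) := fun f g h => by
  rw [← rightGalois_eval f, h, rightGalois_eval]

theorem leftGalois_injective : Function.Injective (leftGalois H) := fun f g h => by
  rw [← leftGalois_eval f, h, leftGalois_eval]

theorem whiskerLeft_rightGalois_comp_mul (f : H ⟶ H) :
    H ◁ rightGalois H f ≫ (α_ H H H).inv ≫ μ[H] ▷ H =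
      ((α_ H H H).inv ≫ μ[H] ▷ H) ≫ rightGalois H f := by
  calc _ = 𝟙 _ ⊗≫ H ◁ H ◁ Δ[H] ⊗≫ H ◁ (H ◁ f) ▷ H ⊗≫ (H ◁ μ[H] ≫ μ[H]) ▷ H ⊗≫ 𝟙 _ := by
        simp only [rightGalois]; monoidal
    _ = 𝟙 _ ⊗≫ (H ⊗ H) ◁ (Δ[H] ≫ f ▷ H) ⊗≫ μ[H] ▷ (H ⊗ H) ⊗≫ μ[H] ▷ H ⊗≫ 𝟙 _ := by
        rw [MonObj.mul_assoc_flip]; monoidal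
    _ = 𝟙 _ ⊗≫ ((H ⊗ H) ◁ (Δ[H] ≫ f ▷ H) ≫ μ[H] ▷ (H ⊗ H)) ⊗≫ μ[H] ▷ H ⊗≫ 𝟙 _ := by
        monoidal
    _ = _ := by
        rw [whisker_exchange]; simp only [rightGalois]; monoidal

theorem leftGalois_whiskerRight_comp_mul (f : H ⟶ H) :
    leftGalois H f ▷ H ≫ (α_ H H H).hom ≫ H ◁ μ[H] =
      ((α_ H H H).hom ≫ H ◁ μ[H]) ≫ leftGalois H f := by
  calc _ = 𝟙 _ ⊗≫ Δ[H] ▷ H ▷ H ⊗≫ H ◁ (f ▷ H) ▷ H ⊗≫ H ◁ (μ[H] ▷ H ≫ μ[H]) ⊗≫ 𝟙 _ := by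
        simp only [leftGalois]; monoidal
    _ = 𝟙 _ ⊗≫ ((Δ[H] ≫ H ◁ f) ▷ (H ⊗ H) ≫ (H ⊗ H) ◁ μ[H]) ⊗≫ H ◁ μ[H] ⊗≫ 𝟙 _ := by
        rw [MonObj.mul_assoc]; monoidal
    _ = _ := by
        rw [← whisker_exchange]; simp only [leftGalois]; monoidal

theorem rightGalois_comp_comul (f : H ⟶ H) :
    rightGalois H f ≫ H ◁ Δ[H] ≫ (α_ H H H).inv =
      (H ◁ Δ[H] ≫ (α_ H H H).inv) ≫ rightGalois H f ▷ H := by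
  calc _ = 𝟙 _ ⊗≫ H ◁ Δ[H] ⊗≫ ((H ◁ f ≫ μ[H]) ▷ H ≫ H ◁ Δ[H]) ⊗≫ 𝟙 _ := by
        simp only [rightGalois]; monoidal
    _ = 𝟙 _ ⊗≫ H ◁ (Δ[H] ≫ H ◁ Δ[H]) ⊗≫ (H ◁ f ≫ μ[H]) ▷ H ▷ H ⊗≫ 𝟙 _ := by
        rw [← whisker_exchange]; monoidal
    _ = _ := by
        rw [ComonObj.comul_assoc]; simp only [rightGalois]; monoidal

theorem leftGalois_comp_comul (f : H ⟶ H) :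
    leftGalois H f ≫ Δ[H] ▷ H ≫ (α_ H H H).hom =
      (Δ[H] ▷ H ≫ (α_ H H H).hom) ≫ H ◁ leftGalois H f := by
  calc _ = 𝟙 _ ⊗≫ Δ[H] ▷ H ⊗≫ (H ◁ (f ▷ H ≫ μ[H]) ≫ Δ[H] ▷ H) ⊗≫ 𝟙 _ := by
        simp only [leftGalois]; monoidal
    _ = 𝟙 _ ⊗≫ (Δ[H] ≫ Δ[H] ▷ H) ▷ H ⊗≫ H ◁ H ◁ (f ▷ H ≫ μ[H]) ⊗≫ 𝟙 _ := by
        rw [whisker_exchange]; monoidal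
    _ = _ := by
        rw [ComonObj.comul_assoc_flip]; simp only [leftGalois]; monoidal

/-- An endomorphism of `H ⊗ H` that is left `H`-linear and right `H`-colinear has the form
`x ⊗ y ↦ x f(y₁) ⊗ y₂`. -/
theorem exists_eq_rightGalois {t : H ⊗ H ⟶ H ⊗ H}
    (hl : H ◁ t ≫ (α_ H H H).inv ≫ μ[H] ▷ H = ((α_ H H H).inv ≫ μ[H] ▷ H) ≫ t)
    (hr : t ≫ H ◁ Δ[H] ≫ (α_ H H H).inv = (H ◁ Δ[H] ≫ (α_ H H H).inv) ≫ t ▷ H) :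
    ∃ f, rightGalois H f = t := by
  -- The witness is forced by `rightGalois_eval`. Colinearity then restores the second leg erased by
  -- `ε`, and linearity restores the factor replaced by `η`.
  refine ⟨(λ_ H).inv ≫ η[H] ▷ H ≫ t ≫ H ◁ ε[H] ≫ (ρ_ H).hom, ?_⟩
  calc _ = 𝟙 _ ⊗≫ H ◁ (Δ[H] ⊗≫ η[H] ▷ H ▷ H ⊗≫ t ▷ H ⊗≫ H ◁ ε[H] ▷ H) ⊗≫ μ[H] ▷ H ⊗≫ 𝟙 _ := by
        simp only [rightGalois]; monoidal
    _ = 𝟙 _ ⊗≫ H ◁ (𝟙 H ⊗≫ (𝟙_ C ◁ Δ[H] ≫ η[H] ▷ (H ⊗ H)) ⊗≫ t ▷ H ⊗≫ H ◁ ε[H] ▷ H)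
          ⊗≫ μ[H] ▷ H ⊗≫ 𝟙 _ := by
        monoidal
    _ = 𝟙 _ ⊗≫ H ◁ (𝟙 H ⊗≫ η[H] ▷ H ⊗≫ ((H ◁ Δ[H] ≫ (α_ H H H).inv) ≫ t ▷ H)
          ⊗≫ H ◁ ε[H] ▷ H) ⊗≫ μ[H] ▷ H ⊗≫ 𝟙 _ := by
        rw [whisker_exchange]; monoidal
    _ = 𝟙 _ ⊗≫ H ◁ η[H] ▷ H ⊗≫ H ◁ t ⊗≫ H ◁ H ◁ (Δ[H] ≫ ε[H] ▷ H) ⊗≫ μ[H] ▷ H ⊗≫ 𝟙 _ := by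
        rw [← hr]; monoidal
    _ = 𝟙 _ ⊗≫ H ◁ η[H] ▷ H ⊗≫ (H ◁ t ≫ (α_ H H H).inv ≫ μ[H] ▷ H) ⊗≫ 𝟙 _ := by
        rw [ComonObj.counit_comul]; monoidal
    _ = 𝟙 _ ⊗≫ (H ◁ η[H] ≫ μ[H]) ▷ H ⊗≫ t ⊗≫ 𝟙 _ := by
        rw [hl]; monoidal
    _ = t := by
        rw [MonObj.mul_one]; monoidal

/-- An endomorphism of `H ⊗ H` that is right `H`-linear and left `H`-colinear has the form
`x ⊗ y ↦ x₁ ⊗ f(x₂) y`. -/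
theorem exists_eq_leftGalois {t : H ⊗ H ⟶ H ⊗ H}
    (hl : t ▷ H ≫ (α_ H H H).hom ≫ H ◁ μ[H] = ((α_ H H H).hom ≫ H ◁ μ[H]) ≫ t)
    (hr : t ≫ Δ[H] ▷ H ≫ (α_ H H H).hom = (Δ[H] ▷ H ≫ (α_ H H H).hom) ≫ H ◁ t) :
    ∃ f, leftGalois H f = t := by
  refine ⟨(ρ_ H).inv ≫ H ◁ η[H] ≫ t ≫ ε[H] ▷ H ≫ (λ_ H).hom, ?_⟩
  calc _ = 𝟙 _ ⊗≫ (Δ[H] ⊗≫ H ◁ H ◁ η[H] ⊗≫ H ◁ t ⊗≫ H ◁ ε[H] ▷ H) ▷ H ⊗≫ H ◁ μ[H] ⊗≫ 𝟙 _ := by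
        simp only [leftGalois]; monoidal
    _ = 𝟙 _ ⊗≫ (𝟙 H ⊗≫ (Δ[H] ▷ 𝟙_ C ≫ (H ⊗ H) ◁ η[H]) ⊗≫ H ◁ t ⊗≫ H ◁ ε[H] ▷ H) ▷ H
          ⊗≫ H ◁ μ[H] ⊗≫ 𝟙 _ := by
        monoidal
    _ = 𝟙 _ ⊗≫ (𝟙 H ⊗≫ H ◁ η[H] ⊗≫ ((Δ[H] ▷ H ≫ (α_ H H H).hom) ≫ H ◁ t)
          ⊗≫ H ◁ ε[H] ▷ H) ▷ H ⊗≫ H ◁ μ[H] ⊗≫ 𝟙 _ := by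
        rw [← whisker_exchange]; monoidal
    _ = 𝟙 _ ⊗≫ H ◁ η[H] ▷ H ⊗≫ t ▷ H ⊗≫ (Δ[H] ≫ H ◁ ε[H]) ▷ H ▷ H ⊗≫ H ◁ μ[H] ⊗≫ 𝟙 _ := by
        rw [← hr]; monoidal
    _ = 𝟙 _ ⊗≫ H ◁ η[H] ▷ H ⊗≫ (t ▷ H ≫ (α_ H H H).hom ≫ H ◁ μ[H]) ⊗≫ 𝟙 _ := by
        rw [ComonObj.comul_counit]; monoidal
    _ = 𝟙 _ ⊗≫ H ◁ (η[H] ▷ H ≫ μ[H]) ⊗≫ t ⊗≫ 𝟙 _ := by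
        rw [hl]; monoidal
    _ = t := by
        rw [MonObj.one_mul]; monoidal

/-- `f` is a generalized convolution inverse of the identity. -/
structure IsConvInverse (p q f : H ⟶ H) : Prop where
  id_conv : conv (𝟙 H) f = p
  conv_id : conv f (𝟙 H) = q
  conv_left : conv f p = f
  right_conv : conv q f = f

/-- Linearity and colinearity pass to `b'`, so `b'` has the form `rightGalois H f`, and its four
equations can be read off in the convolution algebra. -/
theorem exists_isGenInverse_rightGalois_iff (p q : H ⟶ H) :
    (∃ b', IsGenInverse (rightGalois H p) (rightGalois H q) (rightGalois H (𝟙 H)) b') ↔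
      ∃ f, IsConvInverse p q f := by
  constructor
  · rintro ⟨b', hb⟩
    obtain ⟨f, rfl⟩ := exists_eq_rightGalois
      (hb.map_comp_algebra (tensorLeft H) ((α_ H H H).inv ≫ μ[H] ▷ H)
        (whiskerLeft_rightGalois_comp_mul _)
        (whiskerLeft_rightGalois_comp_mul _) (whiskerLeft_rightGalois_comp_mul _))
      (hb.comp_map_coalgebra (tensorRight H) (H ◁ Δ[H] ≫ (α_ H H H).inv)
        (rightGalois_comp_comul _)
        (rightGalois_comp_comul _) (rightGalois_comp_comul _))
    obtain ⟨h₁, h₂, h₃, h₄⟩ := hb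
    rw [rightGalois_comp] at h₁ h₂ h₃ h₄
    exact ⟨f, rightGalois_injective h₁, rightGalois_injective h₂, rightGalois_injective h₄,
      rightGalois_injective h₃⟩
  · rintro ⟨f, h₁, h₂, h₃, h₄⟩
    refine ⟨rightGalois H f, ?_, ?_, ?_, ?_⟩ <;> rw [rightGalois_comp]
    exacts [by rw [h₁], by rw [h₂], by rw [h₄], by rw [h₃]]

/-- Because `leftGalois` reverses products, `q` labels the source idempotent here and `p` the target
one. -/
theorem exists_isGenInverse_leftGalois_iff (p q : H ⟶ H) :
    (∃ b', IsGenInverse (leftGalois H q) (leftGalois H p) (leftGalois H (𝟙 H)) b') ↔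
      ∃ f, IsConvInverse p q f := by
  constructor
  · rintro ⟨b', hb⟩
    obtain ⟨f, rfl⟩ := exists_eq_leftGalois
      (hb.map_comp_algebra (tensorRight H) ((α_ H H H).hom ≫ H ◁ μ[H])
        (leftGalois_whiskerRight_comp_mul _)
        (leftGalois_whiskerRight_comp_mul _) (leftGalois_whiskerRight_comp_mul _))
      (hb.comp_map_coalgebra (tensorLeft H) (Δ[H] ▷ H ≫ (α_ H H H).hom)
        (leftGalois_comp_comul _)
        (leftGalois_comp_comul _) (leftGalois_comp_comul _))
    obtain ⟨h₁, h₂, h₃, h₄⟩ := hb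
    rw [leftGalois_comp] at h₁ h₂ h₃ h₄
    exact ⟨f, leftGalois_injective h₂, leftGalois_injective h₁, leftGalois_injective h₃,
      leftGalois_injective h₄⟩
  · rintro ⟨f, h₁, h₂, h₃, h₄⟩
    refine ⟨leftGalois H f, ?_, ?_, ?_, ?_⟩ <;> rw [leftGalois_comp]
    exacts [by rw [h₂], by rw [h₁], by rw [h₃], by rw [h₄]]

end Convolution

/-! ### Convolution identities for `Π^L` and `Π^R` in a weak bimonoid. -/

section Projections

variable {C : Type u} [Category.{v} C] [MonoidalCategory C] [BraidedCategory C]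
variable (H : C) [MonObj H] [ComonObj H]

/-- The morphism `x ↦ 1₁ x ⊗ 1₂`, where the second leg passes over `x` by the braiding. -/
def unitComulMul : H ⟶ H ⊗ H :=
  (λ_ H).inv ≫ (η[H] ≫ Δ[H]) ▷ H ≫ (α_ H H H).hom ≫ H ◁ (β_ H H).hom ≫ (α_ H H H).inv ≫
    μ[H] ▷ H

/-- The morphism `x ↦ 1₁ ⊗ x 1₂`, where `x` passes over the first leg by the braiding. -/
def mulUnitComul : H ⟶ H ⊗ H :=
  (ρ_ H).inv ≫ H ◁ (η[H] ≫ Δ[H]) ≫ (α_ H H H).inv ≫ (β_ H H).hom ▷ H ≫ (α_ H H H).hom ≫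
    H ◁ μ[H]

theorem unitComulMul_counit : unitComulMul H ≫ ε[H] ▷ H ≫ (λ_ H).hom = piL H := by
  simp only [unitComulMul, piL]; monoidal

theorem mulUnitComul_counit : mulUnitComul H ≫ H ◁ ε[H] ≫ (ρ_ H).hom = piR H := by
  simp only [mulUnitComul, piR]; monoidal

/-- A strand crossing both legs of `δ ∘ η` crosses the unit object, hence can be straightened. So
braiding past one leg equals the inverse braiding past the other, which is the form matching axiom
(b3) with `c⁻¹`. -/
theorem unitComulMul_eq_braiding_inv :
    unitComulMul H =
      (ρ_ H).inv ≫ H ◁ (η[H] ≫ Δ[H]) ≫ (α_ H H H).inv ≫ ((β_ H H).inv ≫ μ[H]) ▷ H := by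
  have h := BraidedCategory.braiding_naturality_left (η[H] ≫ Δ[H]) H
  rw [BraidedCategory.braiding_tensor_left_hom, braiding_tensorUnit_left, Category.assoc,
    ← Iso.inv_comp_eq] at h
  rw [← reassoc_of% h]
  simp [unitComulMul]

theorem mulUnitComul_eq_braiding_inv :
    mulUnitComul H =
      (λ_ H).inv ≫ (η[H] ≫ Δ[H]) ▷ H ≫ (α_ H H H).hom ≫ H ◁ ((β_ H H).inv ≫ μ[H]) := by
  have h := BraidedCategory.braiding_naturality_right H (η[H] ≫ Δ[H])
  rw [BraidedCategory.braiding_tensor_right_hom, braiding_tensorUnit_right, Category.assoc,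
    ← Iso.inv_comp_eq] at h
  rw [← reassoc_of% h]
  simp [mulUnitComul]

/-- Right linearity: `1₁ (x y) ⊗ 1₂ = (1₁ x) y ⊗ 1₂`, where `1₂` is braided past `y`. -/
theorem mul_unitComulMul :
    μ[H] ≫ unitComulMul H =
      unitComulMul H ▷ H ≫ (α_ H H H).hom ≫ H ◁ (β_ H H).hom ≫ (α_ H H H).inv ≫ μ[H] ▷ H := by
  calc _ = 𝟙 _ ⊗≫ (𝟙_ C ◁ μ[H] ≫ (η[H] ≫ Δ[H]) ▷ H) ⊗≫ H ◁ (β_ H H).hom ⊗≫ μ[H] ▷ H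
          ⊗≫ 𝟙 _ := by
        simp only [unitComulMul]; monoidal
    _ = 𝟙 _ ⊗≫ (η[H] ≫ Δ[H]) ▷ (H ⊗ H) ⊗≫ H ◁ (H ◁ μ[H] ≫ (β_ H H).hom) ⊗≫ μ[H] ▷ H
          ⊗≫ 𝟙 _ := by
        rw [whisker_exchange]; monoidal
    _ = 𝟙 _ ⊗≫ (η[H] ≫ Δ[H]) ▷ (H ⊗ H) ⊗≫ H ◁ (β_ H H).hom ▷ H ⊗≫ H ◁ H ◁ (β_ H H).hom ⊗≫
          (H ◁ μ[H] ≫ μ[H]) ▷ H ⊗≫ 𝟙 _ := by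
        rw [BraidedCategory.braiding_naturality_right, BraidedCategory.braiding_tensor_right_hom]
        monoidal
    _ = 𝟙 _ ⊗≫ (η[H] ≫ Δ[H]) ▷ (H ⊗ H) ⊗≫ H ◁ (β_ H H).hom ▷ H ⊗≫
          ((H ⊗ H) ◁ (β_ H H).hom ≫ μ[H] ▷ (H ⊗ H)) ⊗≫ μ[H] ▷ H ⊗≫ 𝟙 _ := by
        rw [MonObj.mul_assoc_flip]; monoidal
    _ = _ := by
        rw [whisker_exchange]; simp only [unitComulMul]; monoidal

theorem mul_mulUnitComul :
    μ[H] ≫ mulUnitComul H =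
      H ◁ mulUnitComul H ≫ (α_ H H H).inv ≫ (β_ H H).hom ▷ H ≫ (α_ H H H).hom ≫ H ◁ μ[H] := by
  calc _ = 𝟙 _ ⊗≫ (μ[H] ▷ 𝟙_ C ≫ H ◁ (η[H] ≫ Δ[H])) ⊗≫ (β_ H H).hom ▷ H ⊗≫ H ◁ μ[H]
          ⊗≫ 𝟙 _ := by
        simp only [mulUnitComul]; monoidal
    _ = 𝟙 _ ⊗≫ (H ⊗ H) ◁ (η[H] ≫ Δ[H]) ⊗≫ (μ[H] ▷ H ≫ (β_ H H).hom) ▷ H ⊗≫ H ◁ μ[H]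
          ⊗≫ 𝟙 _ := by
        rw [← whisker_exchange]; monoidal
    _ = 𝟙 _ ⊗≫ (H ⊗ H) ◁ (η[H] ≫ Δ[H]) ⊗≫ H ◁ (β_ H H).hom ▷ H ⊗≫ (β_ H H).hom ▷ H ▷ H ⊗≫
          H ◁ (μ[H] ▷ H ≫ μ[H]) ⊗≫ 𝟙 _ := by
        rw [BraidedCategory.braiding_naturality_left, BraidedCategory.braiding_tensor_left_hom]
        monoidal
    _ = 𝟙 _ ⊗≫ (H ⊗ H) ◁ (η[H] ≫ Δ[H]) ⊗≫ H ◁ (β_ H H).hom ▷ H ⊗≫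
          ((β_ H H).hom ▷ (H ⊗ H) ≫ (H ⊗ H) ◁ μ[H]) ⊗≫ H ◁ μ[H] ⊗≫ 𝟙 _ := by
        rw [MonObj.mul_assoc]; monoidal
    _ = _ := by
        rw [← whisker_exchange]; simp only [mulUnitComul]; monoidal

/-- The same linearity for the product of `H ⊗ H`, acting on the second leg. It serves to extract
`unitComulMul` from `δ(1) δ(x)` in `unitComulMul_comul`. -/
theorem tensorMul_unitComulMul :
    tensorμ H H H H ≫ (μ[H] ⊗ₘ μ[H]) ≫ H ◁ unitComulMul H =
      (H ◁ unitComulMul H) ▷ (H ⊗ H) ⊗≫ (H ⊗ H) ◁ (β_ H (H ⊗ H)).hom ⊗≫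
        (tensorμ H H H H ≫ (μ[H] ⊗ₘ μ[H])) ▷ H ⊗≫ 𝟙 _ := by
  calc _ = 𝟙 _ ⊗≫ H ◁ (β_ H H).hom ▷ H ⊗≫ μ[H] ▷ (H ⊗ H) ⊗≫ H ◁ (μ[H] ≫ unitComulMul H) := by
        simp only [MonoidalCategory.tensorHom_def, tensorμ]; monoidal
    _ = 𝟙 _ ⊗≫ H ◁ (β_ H H).hom ▷ H ⊗≫ (μ[H] ▷ (H ⊗ H) ≫ H ◁ (unitComulMul H ▷ H)) ⊗≫
          H ◁ (H ◁ (β_ H H).hom ⊗≫ μ[H] ▷ H) := by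
        rw [mul_unitComulMul]; monoidal
    _ = 𝟙 _ ⊗≫ H ◁ ((β_ H H).hom ≫ H ◁ unitComulMul H) ▷ H ⊗≫ μ[H] ▷ (H ⊗ H ⊗ H) ⊗≫
          H ◁ (H ◁ (β_ H H).hom ⊗≫ μ[H] ▷ H) := by
        rw [← whisker_exchange]; monoidal
    _ = 𝟙 _ ⊗≫ H ◁ unitComulMul H ▷ (H ⊗ H) ⊗≫ (H ⊗ H) ◁ (β_ H H).hom ▷ H ⊗≫
          H ◁ (β_ H H).hom ▷ (H ⊗ H) ⊗≫ (μ[H] ▷ (H ⊗ H ⊗ H) ≫ H ◁ (H ◁ (β_ H H).hom)) ⊗≫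
          H ◁ (μ[H] ▷ H) := by
        rw [← BraidedCategory.braiding_naturality_left, BraidedCategory.braiding_tensor_left_hom]
        monoidal
    _ = 𝟙 _ ⊗≫ H ◁ unitComulMul H ▷ (H ⊗ H) ⊗≫ (H ⊗ H) ◁ (β_ H H).hom ▷ H ⊗≫
          H ◁ ((β_ H H).hom ▷ (H ⊗ H) ≫ (H ⊗ H) ◁ (β_ H H).hom) ⊗≫ μ[H] ▷ H ▷ H ▷ H ⊗≫
          H ◁ (μ[H] ▷ H) := by
        rw [← whisker_exchange]; monoidal
    _ = _ := by
        rw [← whisker_exchange, BraidedCategory.braiding_tensor_right_hom]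
        simp only [MonoidalCategory.tensorHom_def, tensorμ]; monoidal

theorem tensorMul_mulUnitComul :
    tensorμ H H H H ≫ (μ[H] ⊗ₘ μ[H]) ≫ mulUnitComul H ▷ H =
      (H ⊗ H) ◁ (mulUnitComul H ▷ H) ⊗≫ (β_ (H ⊗ H) H).hom ▷ (H ⊗ H) ⊗≫
        H ◁ (tensorμ H H H H ≫ (μ[H] ⊗ₘ μ[H])) ⊗≫ 𝟙 _ := by
  calc _ = 𝟙 _ ⊗≫ H ◁ (β_ H H).hom ▷ H ⊗≫ (H ⊗ H) ◁ μ[H] ⊗≫ (μ[H] ≫ mulUnitComul H) ▷ H := by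
        simp only [MonoidalCategory.tensorHom_def', tensorμ]; monoidal
    _ = 𝟙 _ ⊗≫ H ◁ (β_ H H).hom ▷ H ⊗≫ ((H ⊗ H) ◁ μ[H] ≫ (H ◁ mulUnitComul H) ▷ H) ⊗≫
          ((β_ H H).hom ▷ H ⊗≫ H ◁ μ[H]) ▷ H := by
        rw [mul_mulUnitComul]; monoidal
    _ = 𝟙 _ ⊗≫ H ◁ ((β_ H H).hom ≫ mulUnitComul H ▷ H) ▷ H ⊗≫ (H ⊗ H ⊗ H) ◁ μ[H] ⊗≫
          ((β_ H H).hom ▷ H ⊗≫ H ◁ μ[H]) ▷ H := by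
        rw [whisker_exchange]; monoidal
    _ = 𝟙 _ ⊗≫ (H ⊗ H) ◁ mulUnitComul H ▷ H ⊗≫ H ◁ (β_ H H).hom ▷ (H ⊗ H) ⊗≫
          (H ⊗ H) ◁ (β_ H H).hom ▷ H ⊗≫ (((H ⊗ H) ⊗ H) ◁ μ[H] ≫ ((β_ H H).hom ▷ H) ▷ H) ⊗≫
          (H ◁ μ[H]) ▷ H := by
        rw [← BraidedCategory.braiding_naturality_right,
          BraidedCategory.braiding_tensor_right_hom]
        monoidal
    _ = 𝟙 _ ⊗≫ (H ⊗ H) ◁ mulUnitComul H ▷ H ⊗≫ H ◁ (β_ H H).hom ▷ (H ⊗ H) ⊗≫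
          ((H ⊗ H) ◁ (β_ H H).hom ≫ (β_ H H).hom ▷ (H ⊗ H)) ▷ H ⊗≫ H ◁ H ◁ H ◁ μ[H] ⊗≫
          (H ◁ μ[H]) ▷ H := by
        rw [whisker_exchange]; monoidal
    _ = _ := by
        rw [whisker_exchange, BraidedCategory.braiding_tensor_left_hom]
        simp only [MonoidalCategory.tensorHom_def', tensorμ]; monoidal

namespace IsWeakBimonoid

variable {H}

theorem unit_comul_unitComulMul (hH : IsWeakBimonoid H) :
    (η[H] ≫ Δ[H]) ≫ Δ[H] ▷ H = (η[H] ≫ Δ[H]) ≫ H ◁ unitComulMul H ≫ (α_ H H H).inv := by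
  rw [Category.assoc, hH.one_comul_braid, unitComulMul_eq_braiding_inv]
  simp only [MonoidalCategory.tensorHom_def]
  monoidal

theorem unit_comul_mulUnitComul (hH : IsWeakBimonoid H) :
    (η[H] ≫ Δ[H]) ≫ H ◁ Δ[H] = (η[H] ≫ Δ[H]) ≫ mulUnitComul H ▷ H ≫ (α_ H H H).hom := by
  rw [Category.assoc, ComonObj.comul_assoc, reassoc_of% hH.one_comul_braid,
    mulUnitComul_eq_braiding_inv]
  simp only [MonoidalCategory.tensorHom_def']
  monoidal

/-- This is `δ(1) δ(x) = δ(1 x)`; `δ(1)` need not be `1 ⊗ 1`, so it cannot be dropped termwise. -/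
theorem unit_whiskerRight_comul_mul (hH : IsWeakBimonoid H) :
    (η[H] ≫ Δ[H]) ▷ H ≫ (H ⊗ H) ◁ Δ[H] ≫ tensorμ H H H H ≫ (μ[H] ⊗ₘ μ[H]) =
      (λ_ H).hom ≫ Δ[H] := by
  rw [← MonObj.one_mul, Category.assoc, hH.mul_comul]
  simp [MonoidalCategory.tensorHom_def]

theorem unit_whiskerLeft_comul_mul (hH : IsWeakBimonoid H) :
    H ◁ (η[H] ≫ Δ[H]) ≫ Δ[H] ▷ (H ⊗ H) ≫ tensorμ H H H H ≫ (μ[H] ⊗ₘ μ[H]) =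
      (ρ_ H).hom ≫ Δ[H] := by
  rw [← MonObj.mul_one, Category.assoc, hH.mul_comul]
  simp [MonoidalCategory.tensorHom_def']

/-- Expand `δ(1₁ x)` by multiplicativity, rewrite `δ(1₁) ⊗ 1₂` by (b3) as `1₁ ⊗ 1'₁ 1₂ ⊗ 1'₂`, and
recombine `δ(1) δ(x) = δ(x)`. The result is `x₁ ⊗ 1₁ x₂ ⊗ 1₂`. -/
theorem unitComulMul_comul (hH : IsWeakBimonoid H) :
    unitComulMul H ≫ Δ[H] ▷ H = Δ[H] ≫ H ◁ unitComulMul H ≫ (α_ H H H).inv := by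
  calc _ = 𝟙 _ ⊗≫ (η[H] ≫ Δ[H]) ▷ H ⊗≫ H ◁ (β_ H H).hom ⊗≫ (μ[H] ≫ Δ[H]) ▷ H := by
        simp only [unitComulMul]; monoidal
    _ = 𝟙 _ ⊗≫ (η[H] ≫ Δ[H]) ▷ H ⊗≫ (H ◁ (β_ H H).hom ≫ Δ[H] ▷ (H ⊗ H)) ⊗≫
          (H ⊗ H) ◁ Δ[H] ▷ H ⊗≫ (tensorμ H H H H ≫ (μ[H] ⊗ₘ μ[H])) ▷ H := by
        rw [hH.mul_comul, MonoidalCategory.tensorHom_def Δ[H] Δ[H]]; monoidal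
    _ = 𝟙 _ ⊗≫ ((η[H] ≫ Δ[H]) ≫ Δ[H] ▷ H) ▷ H ⊗≫ (H ⊗ H) ◁ ((β_ H H).hom ≫ Δ[H] ▷ H) ⊗≫
          (tensorμ H H H H ≫ (μ[H] ⊗ₘ μ[H])) ▷ H := by
        rw [whisker_exchange]; monoidal
    _ = 𝟙 _ ⊗≫ (η[H] ≫ Δ[H]) ▷ H ⊗≫ ((H ◁ unitComulMul H) ▷ H ≫ (H ⊗ H ⊗ H) ◁ Δ[H]) ⊗≫
          (H ⊗ H) ◁ (β_ H (H ⊗ H)).hom ⊗≫ (tensorμ H H H H ≫ (μ[H] ⊗ₘ μ[H])) ▷ H := by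
        rw [hH.unit_comul_unitComulMul, ← BraidedCategory.braiding_naturality_right]; monoidal
    _ = 𝟙 _ ⊗≫ (η[H] ≫ Δ[H]) ▷ H ⊗≫ (H ⊗ H) ◁ Δ[H] ⊗≫ ((H ◁ unitComulMul H) ▷ (H ⊗ H) ⊗≫
          (H ⊗ H) ◁ (β_ H (H ⊗ H)).hom ⊗≫ (tensorμ H H H H ≫ (μ[H] ⊗ₘ μ[H])) ▷ H ⊗≫
          𝟙 (H ⊗ H ⊗ H)) ⊗≫ 𝟙 _ := by
        rw [← whisker_exchange]; monoidal
    _ = 𝟙 _ ⊗≫ ((η[H] ≫ Δ[H]) ▷ H ≫ (H ⊗ H) ◁ Δ[H] ≫ tensorμ H H H H ≫ (μ[H] ⊗ₘ μ[H])) ⊗≫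
          H ◁ unitComulMul H ⊗≫ 𝟙 _ := by
        rw [← tensorMul_unitComulMul]; monoidal
    _ = _ := by
        rw [hH.unit_whiskerRight_comul_mul]; monoidal

theorem mulUnitComul_comul (hH : IsWeakBimonoid H) :
    mulUnitComul H ≫ H ◁ Δ[H] = Δ[H] ≫ mulUnitComul H ▷ H ≫ (α_ H H H).hom := by
  calc _ = 𝟙 _ ⊗≫ H ◁ (η[H] ≫ Δ[H]) ⊗≫ (β_ H H).hom ▷ H ⊗≫ H ◁ (μ[H] ≫ Δ[H]) := by
        simp only [mulUnitComul]; monoidal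
    _ = 𝟙 _ ⊗≫ H ◁ (η[H] ≫ Δ[H]) ⊗≫ ((β_ H H).hom ▷ H ≫ (H ⊗ H) ◁ Δ[H]) ⊗≫
          H ◁ (Δ[H] ▷ (H ⊗ H)) ⊗≫ H ◁ (tensorμ H H H H ≫ (μ[H] ⊗ₘ μ[H])) := by
        rw [hH.mul_comul, MonoidalCategory.tensorHom_def' Δ[H] Δ[H]]; monoidal
    _ = 𝟙 _ ⊗≫ H ◁ ((η[H] ≫ Δ[H]) ≫ H ◁ Δ[H]) ⊗≫ ((β_ H H).hom ≫ H ◁ Δ[H]) ▷ (H ⊗ H) ⊗≫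
          H ◁ (tensorμ H H H H ≫ (μ[H] ⊗ₘ μ[H])) := by
        rw [← whisker_exchange]; monoidal
    _ = 𝟙 _ ⊗≫ H ◁ (η[H] ≫ Δ[H]) ⊗≫ (H ◁ (mulUnitComul H ▷ H) ≫ Δ[H] ▷ ((H ⊗ H) ⊗ H)) ⊗≫
          (β_ (H ⊗ H) H).hom ▷ (H ⊗ H) ⊗≫ H ◁ (tensorμ H H H H ≫ (μ[H] ⊗ₘ μ[H])) := by
        rw [hH.unit_comul_mulUnitComul, ← BraidedCategory.braiding_naturality_left]; monoidal
    _ = 𝟙 _ ⊗≫ H ◁ (η[H] ≫ Δ[H]) ⊗≫ Δ[H] ▷ (H ⊗ H) ⊗≫ ((H ⊗ H) ◁ (mulUnitComul H ▷ H) ⊗≫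
          (β_ (H ⊗ H) H).hom ▷ (H ⊗ H) ⊗≫ H ◁ (tensorμ H H H H ≫ (μ[H] ⊗ₘ μ[H])) ⊗≫
          𝟙 ((H ⊗ H) ⊗ H)) ⊗≫ 𝟙 _ := by
        rw [whisker_exchange]; monoidal
    _ = 𝟙 _ ⊗≫ (H ◁ (η[H] ≫ Δ[H]) ≫ Δ[H] ▷ (H ⊗ H) ≫ tensorμ H H H H ≫ (μ[H] ⊗ₘ μ[H])) ⊗≫
          mulUnitComul H ▷ H ⊗≫ 𝟙 _ := by
        rw [← tensorMul_mulUnitComul]; monoidal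
    _ = _ := by
        rw [hH.unit_whiskerLeft_comul_mul]; monoidal

/-- Apply `ε` to the middle leg of `unitComulMul_comul`: this gives `x₁ ⊗ Π^L(x₂) = 1₁ x ⊗ 1₂`. -/
theorem comul_piL (hH : IsWeakBimonoid H) : Δ[H] ≫ H ◁ piL H = unitComulMul H := by
  calc _ = (Δ[H] ≫ H ◁ unitComulMul H ≫ (α_ H H H).inv) ⊗≫ (H ◁ ε[H]) ▷ H ⊗≫ 𝟙 _ := by
        rw [← unitComulMul_counit]; monoidal
    _ = unitComulMul H ⊗≫ (Δ[H] ≫ H ◁ ε[H]) ▷ H ⊗≫ 𝟙 _ := by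
        rw [← hH.unitComulMul_comul]; monoidal
    _ = _ := by
        rw [ComonObj.comul_counit]; monoidal

theorem comul_piR (hH : IsWeakBimonoid H) : Δ[H] ≫ piR H ▷ H = mulUnitComul H := by
  calc _ = (Δ[H] ≫ mulUnitComul H ▷ H ≫ (α_ H H H).hom) ⊗≫ H ◁ (ε[H] ▷ H) ⊗≫ 𝟙 _ := by
        rw [← mulUnitComul_counit]; monoidal
    _ = mulUnitComul H ⊗≫ H ◁ (Δ[H] ≫ ε[H] ▷ H) ⊗≫ 𝟙 _ := by
        rw [← hH.mulUnitComul_comul]; monoidal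
    _ = _ := by
        rw [ComonObj.counit_comul]; monoidal

/-- Here `Π^L(x₁) x₂ = ε(1₁ x₁) 1₂ x₂`, which is `ε ⊗ H` applied to `δ(1) δ(x) = δ(x)`. -/
theorem piL_conv_id (hH : IsWeakBimonoid H) : conv (piL H) (𝟙 H) = 𝟙 H := by
  calc _ = 𝟙 _ ⊗≫ (𝟙_ C ◁ Δ[H] ≫ (η[H] ≫ Δ[H]) ▷ (H ⊗ H)) ⊗≫ H ◁ (β_ H H).hom ▷ H ⊗≫
          (μ[H] ≫ ε[H]) ▷ (H ⊗ H) ⊗≫ μ[H] := by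
        simp only [conv, piL, MonoidalCategory.tensorHom_def]; monoidal
    _ = 𝟙 _ ⊗≫ (η[H] ≫ Δ[H]) ▷ H ⊗≫ (H ⊗ H) ◁ Δ[H] ⊗≫ H ◁ (β_ H H).hom ▷ H ⊗≫
          μ[H] ▷ (H ⊗ H) ⊗≫ (ε[H] ▷ (H ⊗ H) ≫ 𝟙_ C ◁ μ[H]) ⊗≫ 𝟙 _ := by
        rw [whisker_exchange]; monoidal
    _ = 𝟙 _ ⊗≫ ((η[H] ≫ Δ[H]) ▷ H ≫ (H ⊗ H) ◁ Δ[H] ≫ tensorμ H H H H ≫ (μ[H] ⊗ₘ μ[H])) ⊗≫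
          ε[H] ▷ H ⊗≫ 𝟙 _ := by
        rw [← whisker_exchange]; simp only [tensorμ, MonoidalCategory.tensorHom_def]; monoidal
    _ = 𝟙 _ ⊗≫ (Δ[H] ≫ ε[H] ▷ H) ⊗≫ 𝟙 _ := by
        rw [hH.unit_whiskerRight_comul_mul]; monoidal
    _ = _ := by
        rw [ComonObj.counit_comul]; monoidal

theorem id_conv_piR (hH : IsWeakBimonoid H) : conv (𝟙 H) (piR H) = 𝟙 H := by
  calc _ = 𝟙 _ ⊗≫ (Δ[H] ▷ 𝟙_ C ≫ (H ⊗ H) ◁ (η[H] ≫ Δ[H])) ⊗≫ H ◁ (β_ H H).hom ▷ H ⊗≫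
          (H ⊗ H) ◁ (μ[H] ≫ ε[H]) ⊗≫ μ[H] := by
        simp only [conv, piR, MonoidalCategory.tensorHom_def]; monoidal
    _ = 𝟙 _ ⊗≫ H ◁ (η[H] ≫ Δ[H]) ⊗≫ Δ[H] ▷ (H ⊗ H) ⊗≫ H ◁ (β_ H H).hom ▷ H ⊗≫
          (H ⊗ H) ◁ μ[H] ⊗≫ ((H ⊗ H) ◁ ε[H] ≫ μ[H] ▷ 𝟙_ C) ⊗≫ 𝟙 _ := by
        rw [← whisker_exchange]; monoidal
    _ = 𝟙 _ ⊗≫ (H ◁ (η[H] ≫ Δ[H]) ≫ Δ[H] ▷ (H ⊗ H) ≫ tensorμ H H H H ≫ (μ[H] ⊗ₘ μ[H])) ⊗≫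
          H ◁ ε[H] ⊗≫ 𝟙 _ := by
        rw [whisker_exchange]; simp only [tensorμ, MonoidalCategory.tensorHom_def']; monoidal
    _ = 𝟙 _ ⊗≫ (Δ[H] ≫ H ◁ ε[H]) ⊗≫ 𝟙 _ := by
        rw [hH.unit_whiskerLeft_comul_mul]; monoidal
    _ = _ := by
        rw [ComonObj.comul_counit]; monoidal

theorem unit_comul_mul_unit_comul (hH : IsWeakBimonoid H) :
    (λ_ (𝟙_ C)).inv ≫ ((η[H] ≫ Δ[H]) ⊗ₘ (η[H] ≫ Δ[H])) ≫ tensorμ H H H H ≫ (μ[H] ⊗ₘ μ[H]) =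
      η[H] ≫ Δ[H] := by
  rw [← MonoidalCategory.tensorHom_comp_tensorHom_assoc, ← hH.mul_comul,
    MonoidalCategory.tensorHom_def]
  simp [← unitors_equal]

theorem unit_comul_unitComulMul_mul (hH : IsWeakBimonoid H) :
    (η[H] ≫ Δ[H]) ≫ unitComulMul H ▷ H ≫ (α_ H H H).hom ≫ H ◁ μ[H] = η[H] ≫ Δ[H] := by
  calc _ = 𝟙 _ ⊗≫ (𝟙_ C ◁ (η[H] ≫ Δ[H]) ≫ (η[H] ≫ Δ[H]) ▷ (H ⊗ H)) ⊗≫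
          H ◁ (β_ H H).hom ▷ H ⊗≫ μ[H] ▷ (H ⊗ H) ⊗≫ H ◁ μ[H] := by
        simp only [unitComulMul]; monoidal
    _ = _ := by
        rw [whisker_exchange]
        conv_rhs => rw [← hH.unit_comul_mul_unit_comul]
        simp only [tensorμ, MonoidalCategory.tensorHom_def]; monoidal

theorem unit_comul_mulUnitComul_mul (hH : IsWeakBimonoid H) :
    (η[H] ≫ Δ[H]) ≫ H ◁ mulUnitComul H ≫ (α_ H H H).inv ≫ μ[H] ▷ H = η[H] ≫ Δ[H] := by
  calc _ = 𝟙 _ ⊗≫ ((η[H] ≫ Δ[H]) ▷ 𝟙_ C ≫ (H ⊗ H) ◁ (η[H] ≫ Δ[H])) ⊗≫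
          H ◁ (β_ H H).hom ▷ H ⊗≫ (H ⊗ H) ◁ μ[H] ⊗≫ μ[H] ▷ H := by
        simp only [mulUnitComul]; monoidal
    _ = _ := by
        rw [← whisker_exchange]
        conv_rhs => rw [← hH.unit_comul_mul_unit_comul]
        simp only [tensorμ, MonoidalCategory.tensorHom_def']; monoidal

/-- By right linearity the composite is `δ(1) δ(1)` acting on `x`, and `δ(1)` is idempotent. -/
theorem unitComulMul_comp_unitComulMul (hH : IsWeakBimonoid H) :
    unitComulMul H ≫ unitComulMul H ▷ H ≫ (α_ H H H).hom ≫ H ◁ μ[H] = unitComulMul H := by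
  calc _ = 𝟙 _ ⊗≫ (η[H] ≫ Δ[H]) ▷ H ⊗≫ H ◁ (β_ H H).hom ⊗≫ (μ[H] ≫ unitComulMul H) ▷ H ⊗≫
          H ◁ μ[H] := by
        simp only [unitComulMul]; monoidal
    _ = 𝟙 _ ⊗≫ (η[H] ≫ Δ[H]) ▷ H ⊗≫ (H ◁ (β_ H H).hom ≫ unitComulMul H ▷ (H ⊗ H)) ⊗≫
          H ◁ (β_ H H).hom ▷ H ⊗≫ (μ[H] ▷ (H ⊗ H) ≫ H ◁ μ[H]) := by
        rw [mul_unitComulMul]; monoidal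
    _ = 𝟙 _ ⊗≫ (η[H] ≫ Δ[H]) ▷ H ⊗≫ unitComulMul H ▷ H ▷ H ⊗≫
          H ◁ ((β_ (H ⊗ H) H).hom ≫ H ◁ μ[H]) ⊗≫ μ[H] ▷ H := by
        rw [whisker_exchange (unitComulMul H), ← whisker_exchange μ[H] μ[H],
          BraidedCategory.braiding_tensor_left_hom]
        monoidal
    _ = 𝟙 _ ⊗≫ ((η[H] ≫ Δ[H]) ≫ unitComulMul H ▷ H ≫ (α_ H H H).hom ≫ H ◁ μ[H]) ▷ H ⊗≫
          H ◁ (β_ H H).hom ⊗≫ μ[H] ▷ H := by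
        rw [← BraidedCategory.braiding_naturality_left]; monoidal
    _ = _ := by
        rw [hH.unit_comul_unitComulMul_mul]; simp only [unitComulMul]; monoidal

theorem mulUnitComul_comp_mulUnitComul (hH : IsWeakBimonoid H) :
    mulUnitComul H ≫ H ◁ mulUnitComul H ≫ (α_ H H H).inv ≫ μ[H] ▷ H = mulUnitComul H := by
  calc _ = 𝟙 _ ⊗≫ H ◁ (η[H] ≫ Δ[H]) ⊗≫ (β_ H H).hom ▷ H ⊗≫ H ◁ (μ[H] ≫ mulUnitComul H) ⊗≫
          μ[H] ▷ H := by
        simp only [mulUnitComul]; monoidal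
    _ = 𝟙 _ ⊗≫ H ◁ (η[H] ≫ Δ[H]) ⊗≫ ((β_ H H).hom ▷ H ≫ (H ⊗ H) ◁ mulUnitComul H) ⊗≫
          H ◁ (β_ H H).hom ▷ H ⊗≫ ((H ⊗ H) ◁ μ[H] ≫ μ[H] ▷ H) := by
        rw [mul_mulUnitComul]; monoidal
    _ = 𝟙 _ ⊗≫ H ◁ (η[H] ≫ Δ[H]) ⊗≫ H ◁ H ◁ mulUnitComul H ⊗≫
          ((β_ H (H ⊗ H)).hom ≫ μ[H] ▷ H) ▷ H ⊗≫ H ◁ μ[H] := by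
        rw [← whisker_exchange (β_ H H).hom, whisker_exchange μ[H] μ[H],
          BraidedCategory.braiding_tensor_right_hom]
        monoidal
    _ = 𝟙 _ ⊗≫ H ◁ ((η[H] ≫ Δ[H]) ≫ H ◁ mulUnitComul H ≫ (α_ H H H).inv ≫ μ[H] ▷ H) ⊗≫
          (β_ H H).hom ▷ H ⊗≫ H ◁ μ[H] := by
        rw [← BraidedCategory.braiding_naturality_right]; monoidal
    _ = _ := by
        rw [hH.unit_comul_mulUnitComul_mul]; simp only [mulUnitComul]; monoidal

/-- `comul_piL` turns the convolution square into the composite of `unitComulMul_comp_unitComulMul`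
followed by `ε` on the first leg. -/
theorem piL_conv_piL (hH : IsWeakBimonoid H) : conv (piL H) (piL H) = piL H := by
  calc _ = (Δ[H] ≫ H ◁ piL H) ≫ piL H ▷ H ≫ μ[H] := by
        simp only [conv, MonoidalCategory.tensorHom_def', Category.assoc]
    _ = unitComulMul H ≫ unitComulMul H ▷ H ⊗≫ (ε[H] ▷ (H ⊗ H) ≫ 𝟙_ C ◁ μ[H]) ⊗≫ 𝟙 _ := by
        rw [hH.comul_piL, ← unitComulMul_counit]; monoidal
    _ = (unitComulMul H ≫ unitComulMul H ▷ H ≫ (α_ H H H).hom ≫ H ◁ μ[H]) ≫ ε[H] ▷ H ≫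
          (λ_ H).hom := by
        rw [← whisker_exchange]; monoidal
    _ = piL H := by
        rw [hH.unitComulMul_comp_unitComulMul, unitComulMul_counit]

theorem piR_conv_piR (hH : IsWeakBimonoid H) : conv (piR H) (piR H) = piR H := by
  calc _ = (Δ[H] ≫ piR H ▷ H) ≫ H ◁ piR H ≫ μ[H] := by
        simp only [conv, MonoidalCategory.tensorHom_def, Category.assoc]
    _ = mulUnitComul H ≫ H ◁ mulUnitComul H ⊗≫ ((H ⊗ H) ◁ ε[H] ≫ μ[H] ▷ 𝟙_ C) ⊗≫ 𝟙 _ := by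
        rw [hH.comul_piR, ← mulUnitComul_counit]; monoidal
    _ = (mulUnitComul H ≫ H ◁ mulUnitComul H ≫ (α_ H H H).inv ≫ μ[H] ▷ H) ≫ H ◁ ε[H] ≫
          (ρ_ H).hom := by
        rw [whisker_exchange]; monoidal
    _ = piR H := by
        rw [hH.mulUnitComul_comp_mulUnitComul, mulUnitComul_counit]

end IsWeakBimonoid

end Projections

/-! ### The antipode as a generalized convolution inverse of the identity. -/

section Antipode

variable {C : Type u} [Category.{v} C] [MonoidalCategory C] [BraidedCategory C]
variable {H : C} [MonObj H] [ComonObj H]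

/-- The four mixed antipode axioms are the first two multiplied by a further factor `H`, by
associativity. -/
theorem isAntipode_iff_isConvInverse (s : H ⟶ H) :
    IsAntipode H s ↔ IsConvInverse (piL H) (piR H) s := by
  refine ⟨fun h => ⟨h.id_conv, h.conv_id, h.conv_piL, h.piR_conv⟩, fun h => ?_⟩
  refine ⟨h.id_conv, h.conv_id, h.conv_left, h.right_conv, ?_, ?_, ?_, ?_⟩
  · rw [← h.conv_id]
    calc _ = Δ[H] ▷ H ⊗≫ s ▷ (H ⊗ H) ⊗≫ (H ◁ μ[H] ≫ μ[H]) := by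
          simp only [MonoidalCategory.tensorHom_def]; monoidal
      _ = _ := by
          rw [MonObj.mul_assoc_flip]
          simp only [conv, MonoidalCategory.tensorHom_def]; monoidal
  · rw [← h.id_conv, MonObj.mul_assoc_flip]
    simp only [conv, MonoidalCategory.tensorHom_def]; monoidal
  · rw [← h.id_conv]
    calc _ = H ◁ Δ[H] ⊗≫ (H ⊗ H) ◁ s ⊗≫ (μ[H] ▷ H ≫ μ[H]) := by
          simp only [MonoidalCategory.tensorHom_def']; monoidal
      _ = _ := by
          rw [MonObj.mul_assoc]
          simp only [conv, MonoidalCategory.tensorHom_def]; monoidal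
  · rw [← h.conv_id, MonObj.mul_assoc]
    simp only [conv, MonoidalCategory.tensorHom_def]; monoidal

theorem isWeakHopfAlgebra_iff (hH : IsWeakBimonoid H) :
    IsWeakHopfAlgebra H ↔ ∃ s, IsConvInverse (piL H) (piR H) s := by
  simp only [← isAntipode_iff_isConvInverse]
  exact ⟨fun h => h.exists_antipode, fun h => ⟨hH, h⟩⟩

end Antipode

/-! ### Invertibility of `s` and `h` in terms of the antipode. -/

section Galois

variable {C : Type u} [Category.{v} C] [MonoidalCategory C] {H : C} [MonObj H] [ComonObj H]

theorem galoisRight_eq : galoisRight H = rightGalois H (𝟙 H) := by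
  simp [galoisRight, rightGalois]

theorem galoisLeft_eq : galoisLeft H = leftGalois H (𝟙 H) := by
  simp [galoisLeft, leftGalois]

variable [BraidedCategory C]

theorem isIso_sMor_iff (hH : IsWeakBimonoid H) (L1 : IdemSplitting (omegaL1 H))
    (R1 : IdemSplitting (omegaR1 H)) :
    IsIso (sMor L1 R1) ↔ ∃ s, IsConvInverse (piL H) (piR H) s := by
  rw [← exists_isGenInverse_rightGalois_iff, sMor, galoisRight_eq]
  refine isIso_iff_exists_isGenInverse L1 R1 ?_ ?_
  · exact (rightGalois_comp _ _).trans (by rw [hH.piL_conv_id])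
  · exact (rightGalois_comp _ _).trans (by rw [hH.id_conv_piR])

theorem isIso_hMor_iff (hH : IsWeakBimonoid H) (R2 : IdemSplitting (omegaR2 H))
    (L2 : IdemSplitting (omegaL2 H)) :
    IsIso (hMor R2 L2) ↔ ∃ s, IsConvInverse (piL H) (piR H) s := by
  rw [← exists_isGenInverse_leftGalois_iff, hMor, galoisLeft_eq]
  refine isIso_iff_exists_isGenInverse R2 L2 ?_ ?_
  -- Order reversal again: precomposing `γ` with `Ω_R^2` amounts to convolving the identity with
  -- `Π^R` on the right.
  · exact (leftGalois_comp _ _).trans (by rw [hH.id_conv_piR])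
  · exact (leftGalois_comp _ _).trans (by rw [hH.piL_conv_id])

end Galois

end WeakHopf

theorem mainTheorem5 {C : Type u} [Category.{v} C] [MonoidalCategory C] [BraidedCategory C]
    [Limits.HasEqualizers C] [Limits.HasCoequalizers C]
    (H : C) [MonObj H] [ComonObj H] (hH : WeakHopf.IsWeakBimonoid H) :
    (Nonempty (WeakHopf.IdemSplitting (WeakHopf.omegaL1 H)) ∧
      Nonempty (WeakHopf.IdemSplitting (WeakHopf.omegaR1 H)) ∧
      Nonempty (WeakHopf.IdemSplitting (WeakHopf.omegaL2 H)) ∧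
      Nonempty (WeakHopf.IdemSplitting (WeakHopf.omegaR2 H))) ∧
    ∀ (L1 : WeakHopf.IdemSplitting (WeakHopf.omegaL1 H))
      (R1 : WeakHopf.IdemSplitting (WeakHopf.omegaR1 H))
      (L2 : WeakHopf.IdemSplitting (WeakHopf.omegaL2 H))
      (R2 : WeakHopf.IdemSplitting (WeakHopf.omegaR2 H)),
      List.TFAE [WeakHopf.IsWeakHopfAlgebra H,
        IsIso (WeakHopf.hMor R2 L2),
        IsIso (WeakHopf.sMor L1 R1)] := by
  refine ⟨⟨?_, ?_, ?_, ?_⟩, fun L1 R1 L2 R2 => ?_⟩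
  · exact WeakHopf.IdemSplitting.nonempty_of_idem
      ((WeakHopf.rightGalois_comp _ _).trans (by rw [hH.piL_conv_piL]; rfl))
  · exact WeakHopf.IdemSplitting.nonempty_of_idem
      ((WeakHopf.rightGalois_comp _ _).trans (by rw [hH.piR_conv_piR]; rfl))
  · exact WeakHopf.IdemSplitting.nonempty_of_idem
      ((WeakHopf.leftGalois_comp _ _).trans (by rw [hH.piL_conv_piL]; rfl))
  · exact WeakHopf.IdemSplitting.nonempty_of_idem
      ((WeakHopf.leftGalois_comp _ _).trans (by rw [hH.piR_conv_piR]; rfl))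
  · have h₁ := WeakHopf.isWeakHopfAlgebra_iff hH
    have h₂ := WeakHopf.isIso_hMor_iff hH R2 L2
    have h₃ := WeakHopf.isIso_sMor_iff hH L1 R1
    tfae_have 1 ↔ 2 := h₁.trans h₂.symm
    tfae_have 1 ↔ 3 := h₁.trans h₃.symm
    tfae_finish
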